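/- Let $0<\beta<1$, let $\gamma_1,\gamma_2>0$, and let $(t_n)_{n\ge 1}$ be a sequence of real numbers such that $\gamma_1\exp(n^\beta)\le t_n\le \gamma_2\exp(n^\beta)$ for all integers $n\ge 1$. Write $\|x\|$ for the distance from the real number $x$ to the nearest integer. Then the set $$\Bigl\{\alpha\in[0,1]:\ \exists\,\varkappa>0\ \ \forall n\ge 1\quad \|t_n\alpha\|>\frac{\varkappa}{n^{1-\beta}\log(n+1)}\Bigr\}$$ has Hausdorff dimension equal to $1$. -/

import Mathlib

/-- The distance `‖x‖ = min_{m ∈ ℤ} |x - m|` from a real number to the nearest integer. -/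
noncomputable def distNearestInt (x : ℝ) : ℝ := |x - (round x : ℝ)|

/-- It is the least distance from `x` to an integer. -/
theorem distNearestInt_isLeast (x : ℝ) :
    IsLeast (Set.range fun m : ℤ => |x - (m : ℝ)|) (distNearestInt x) :=
  ⟨⟨round x, rfl⟩, by rintro _ ⟨m, rfl⟩; exact round_le x m⟩

open MeasureTheory Set Filter Topology
open scoped NNReal ENNReal

/-! Only the lower bound needs work: for every s < 1 the dimension is at least s. The method is a
nested removal of Peres–Schlag type. Cut the indices into windows u_m < n^β ≤ u_(m+1) with u_m = C m
log m, and take dyadic scales q of order exp(u_m). The tolerances δ_n = κ/(n^(1-β) log(n+1)) in a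
window are dominated by increments of n^β divided by log m. Since u_(m+1) - u_m is of order log m,
they sum to at most 1/96 for small κ. The scales grow fast enough that what one window removes is
resolved two levels later. A union of cells of length 1/q_j loses to ‖t_n x‖ ≤ 2δ_n at most a
proportion 12δ_n, so a whole window costs at most 1/8 of the set two stages back, and at each stage
at least half of the measure survives (`exists_forall_lt_notMem`).

No measure on the limit set is needed. Given balls with small Σ ρ^s, each is removed along with the
window of its size; since ρ = ρ^(1-s) ρ^s, the cost at stage j is at most 2^(-j)/16. The surviving
point lies in no ball, so no such family covers the set (`exists_avoiding_balls`,
`le_dimH_of_exists_avoiding_balls`).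

This gives the inequality for large n with κ depending on s. Outside the countable set where some
t_n α is an integer, lowering κ handles the remaining n. -/

/-! ### Saturated sets -/

/-- A set is `q`-saturated if it is a union of intervals `[i / q, (i + 1) / q)`. -/
def FloorSaturated (q : ℕ) (S : Set ℝ) : Prop :=
  ∀ x y : ℝ, ⌊(q : ℝ) * x⌋ = ⌊(q : ℝ) * y⌋ → x ∈ S → y ∈ S

/-- The smallest `q`-saturated set containing `A`. -/
def floorSaturation (q : ℕ) (A : Set ℝ) : Set ℝ :=
  {y | ∃ x ∈ A, ⌊(q : ℝ) * x⌋ = ⌊(q : ℝ) * y⌋}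

theorem floorSaturated_floorSaturation (q : ℕ) (A : Set ℝ) :
    FloorSaturated q (floorSaturation q A) := by
  rintro x y h ⟨z, hz, hzx⟩
  exact ⟨z, hz, hzx.trans h⟩

theorem subset_floorSaturation (q : ℕ) (A : Set ℝ) : A ⊆ floorSaturation q A :=
  fun x hx => ⟨x, hx, rfl⟩

theorem measurable_floor_mul (q : ℕ) : Measurable fun x : ℝ => ⌊(q : ℝ) * x⌋ :=
  Int.measurable_floor.comp (measurable_const_mul _)

theorem FloorSaturated.measurableSet {q : ℕ} {S : Set ℝ} (h : FloorSaturated q S) :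
    MeasurableSet S := by
  have : S = (fun x : ℝ => ⌊(q : ℝ) * x⌋) ⁻¹' ((fun x : ℝ => ⌊(q : ℝ) * x⌋) '' S) := by
    ext y
    constructor
    · exact fun hy => ⟨y, hy, rfl⟩
    · rintro ⟨x, hx, hxy⟩
      exact h x y hxy hx
  rw [this]
  exact measurable_floor_mul q (MeasurableSet.of_discrete)

theorem FloorSaturated.diff {q : ℕ} {S T : Set ℝ} (hS : FloorSaturated q S)
    (hT : FloorSaturated q T) : FloorSaturated q (S \ T) :=
  fun x y h hx => ⟨hS x y h hx.1, fun hy => hx.2 (hT y x h.symm hy)⟩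

/-- Each cell at scale q is a union of cells at scale qd, because ⌊qx⌋ is the integer quotient of
⌊qdx⌋ by d. -/
theorem FloorSaturated.of_dvd {q r : ℕ} (hqr : q ∣ r) (hr : 0 < r) {S : Set ℝ}
    (hS : FloorSaturated q S) : FloorSaturated r S := by
  obtain ⟨d, rfl⟩ := hqr
  have hd : 0 < d := Nat.pos_of_mul_pos_left hr
  have key : ∀ x : ℝ, ⌊(q : ℝ) * x⌋ = ⌊((q * d : ℕ) : ℝ) * x⌋ / (d : ℤ) := by
    intro x
    rw [← Int.floor_div_natCast]
    congr 1
    push_cast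
    field_simp
  intro x y h hx
  exact hS x y (by rw [key, key, h]) hx

theorem floorSaturated_Ico {q : ℕ} (hq : 0 < q) : FloorSaturated q (Ico 0 1) := by
  have key : ∀ x : ℝ, x ∈ Ico (0 : ℝ) 1 ↔ 0 ≤ ⌊(q : ℝ) * x⌋ ∧ ⌊(q : ℝ) * x⌋ < q := by
    intro x
    have : (0 : ℝ) < q := by exact_mod_cast hq
    rw [Int.floor_nonneg, Int.floor_lt, mem_Ico]
    push_cast
    constructor
    · rintro ⟨h1, h2⟩
      exact ⟨by positivity, by nlinarith⟩
    · rintro ⟨h1, h2⟩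
      exact ⟨by by_contra! h; nlinarith, by by_contra! h; nlinarith⟩
  intro x y h hx
  rw [key] at hx ⊢
  rwa [← h]

theorem abs_sub_lt_of_floor_mul_eq {q : ℕ} (hq : 0 < q) {x y : ℝ}
    (h : ⌊(q : ℝ) * x⌋ = ⌊(q : ℝ) * y⌋) : |x - y| < 1 / q := by
  have hq' : (0 : ℝ) < q := by exact_mod_cast hq
  have := Int.abs_sub_lt_one_of_floor_eq_floor h
  rw [← mul_sub, abs_mul, abs_of_pos hq'] at this
  rw [lt_div_iff₀ hq']
  linarith

theorem preimage_floor_mul_singleton {q : ℕ} (hq : 0 < q) (i : ℤ) :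
    (fun x : ℝ => ⌊(q : ℝ) * x⌋) ⁻¹' {i} = Ico ((i : ℝ) / q) ((i : ℝ) / q + 1 / q) := by
  have hq' : (0 : ℝ) < q := by exact_mod_cast hq
  ext x
  rw [mem_preimage, mem_singleton_iff, Int.floor_eq_iff, mem_Ico, ← add_div,
    div_le_iff₀ hq', lt_div_iff₀ hq', mul_comm x]

/-! ### Density of near-integer sets -/

/-- On an interval longer than `1 / t`, the set where `t x` is `δ`-close to an integer has
density at most `6 δ`. -/
theorem volume_Ico_inter_distNearestInt_le {t δ a l : ℝ} (hδ : 0 ≤ δ)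
    (ht : 0 < t) (hl : 1 ≤ t * l) :
    volume (Ico a (a + l) ∩ {x | distNearestInt (t * x) ≤ δ}) ≤ ENNReal.ofReal (6 * δ * l) := by
  -- Rounding moves t x by at most 1/2, so `M` contains every relevant integer whatever the size of
  -- δ.
  set M : Finset ℤ := Finset.Icc ⌈t * a - 1 / 2⌉ ⌊t * (a + l) + 1 / 2⌋ with hM
  have hsub : Ico a (a + l) ∩ {x | distNearestInt (t * x) ≤ δ} ⊆
      ⋃ m ∈ M, Icc ((m - δ) / t) ((m + δ) / t) := by
    rintro x ⟨⟨hx1, hx2⟩, hx⟩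
    have hr := abs_le.1 (abs_sub_round (t * x))
    have hx' := abs_le.1 (show |t * x - (round (t * x) : ℝ)| ≤ δ from hx)
    have h1 : t * a ≤ t * x := by gcongr
    have h2 : t * x ≤ t * (a + l) := by gcongr
    refine mem_biUnion (x := round (t * x)) ?_ ?_
    · rw [hM, Finset.mem_coe, Finset.mem_Icc, Int.ceil_le, Int.le_floor]
      constructor <;> linarith
    · rw [mem_Icc, div_le_iff₀ ht, le_div_iff₀ ht]
      constructor <;> linarith
  have hcard : (M.card : ℝ) ≤ t * l + 2 := by
    rw [hM, Int.card_Icc]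
    have h1 := Int.floor_le (t * (a + l) + 1 / 2)
    have h2 := Int.le_ceil (t * a - 1 / 2)
    rcases le_total 0 (⌊t * (a + l) + 1 / 2⌋ + 1 - ⌈t * a - 1 / 2⌉) with h | h
    · have : ((⌊t * (a + l) + 1 / 2⌋ + 1 - ⌈t * a - 1 / 2⌉).toNat : ℝ) =
          ((⌊t * (a + l) + 1 / 2⌋ + 1 - ⌈t * a - 1 / 2⌉ : ℤ) : ℝ) := by
        exact_mod_cast congrArg (Int.cast : ℤ → ℝ) (Int.toNat_of_nonneg h)
      rw [this]
      push_cast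
      linarith
    · rw [Int.toNat_of_nonpos h]
      push_cast
      linarith
  calc volume (Ico a (a + l) ∩ {x | distNearestInt (t * x) ≤ δ})
      ≤ volume (⋃ m ∈ M, Icc (((m : ℝ) - δ) / t) ((m + δ) / t)) := measure_mono hsub
    _ ≤ ∑ m ∈ M, volume (Icc (((m : ℝ) - δ) / t) ((m + δ) / t)) := measure_biUnion_finset_le _ _
    _ = ∑ m ∈ M, ENNReal.ofReal (2 * δ / t) := by
        refine Finset.sum_congr rfl fun m _ => ?_
        rw [Real.volume_Icc]
        congr 1
        ring
    _ = ENNReal.ofReal (M.card * (2 * δ / t)) := by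
        rw [Finset.sum_const, nsmul_eq_mul, ENNReal.ofReal_mul (by positivity),
          ENNReal.ofReal_natCast]
    _ ≤ ENNReal.ofReal (6 * δ * l) := by
        refine ENNReal.ofReal_le_ofReal ?_
        calc (M.card : ℝ) * (2 * δ / t) ≤ (3 * (t * l)) * (2 * δ / t) := by
              gcongr
              linarith
          _ = 6 * δ * l := by field_simp; ring

/-- A saturated set is a disjoint union of cells of length 1/q ≥ 1/t, so the interval estimate
applies in each cell and sums. -/
theorem FloorSaturated.volume_inter_distNearestInt_le {q : ℕ} (hq : 0 < q) {S : Set ℝ}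
    (hS : FloorSaturated q S) {t δ : ℝ} (hδ : 0 ≤ δ) (hqt : (q : ℝ) ≤ t) :
    volume (S ∩ {x | distNearestInt (t * x) ≤ δ}) ≤ ENNReal.ofReal (6 * δ) * volume S := by
  have hq' : (0 : ℝ) < q := by exact_mod_cast hq
  set f : ℝ → ℤ := fun x => ⌊(q : ℝ) * x⌋ with hf
  have hfm : Measurable f := measurable_floor_mul q
  have split : ∀ T : Set ℝ, volume T = ∑' i : ℤ, volume (f ⁻¹' {i} ∩ T) := by
    intro T
    have h := tsum_measure_preimage_singleton (μ := volume.restrict T) (countable_univ (α := ℤ))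
      (f := f) fun i _ => hfm (measurableSet_singleton i)
    rw [preimage_univ, Measure.restrict_apply_univ, tsum_univ
      (fun i : ℤ => volume.restrict T (f ⁻¹' {i}))] at h
    rw [← h]
    exact tsum_congr fun i => Measure.restrict_apply (hfm (measurableSet_singleton i))
  rw [split, split S, ← ENNReal.tsum_mul_left]
  refine ENNReal.tsum_le_tsum fun i => ?_
  by_cases h : (f ⁻¹' {i} ∩ S).Nonempty
  · obtain ⟨x, hx, hxS⟩ := h
    have hsub : f ⁻¹' {i} ⊆ S := fun y hy => hS x y (hx.trans hy.symm) hxS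
    rw [inter_eq_left.2 hsub, ← inter_assoc, inter_eq_left.2 hsub,
      preimage_floor_mul_singleton hq, Real.volume_Ico, ← ENNReal.ofReal_mul (by positivity)]
    refine (volume_Ico_inter_distNearestInt_le hδ (hq'.trans_le hqt) ?_).trans (le_of_eq ?_)
    · rwa [mul_one_div, le_div_iff₀ hq', one_mul]
    · congr 1
      ring
  · rw [← inter_assoc, not_nonempty_iff_eq_empty.1 h]
    simp

/-! ### Nested removal -/

/-- A nested construction in which the `j`-th forbidden set is small relative to each set
saturated at the level `q j` leaves a point at every finite stage. -/
theorem exists_forall_lt_notMem (q : ℕ → ℕ) (hq : ∀ j, 0 < q j) (hdvd : ∀ j, q j ∣ q (j + 1))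
    (D F : ℕ → Set ℝ)
    (hF : ∀ j x y, x ∈ D j → |x - y| < 1 / q (j + 2) → y ∈ F j)
    (hvol : ∀ j S, FloorSaturated (q j) S →
      volume (S ∩ F j) ≤ ENNReal.ofReal (1 / 8) * volume S + ENNReal.ofReal ((1 / 2) ^ j / 16))
    (j : ℕ) : ∃ x ∈ Ico (0 : ℝ) 1, ∀ i < j, x ∉ D i := by
  -- `D i` is removed in passing from `B (i + 1)` to `B (i + 2)`; nothing is removed in the first
  -- step, so the truncated `i - 1` is harmless.
  let B : ℕ → Set ℝ := fun j => Nat.rec (Ico (0 : ℝ) 1)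
    (fun i S => S \ (if i = 0 then ∅ else floorSaturation (q (i + 1)) (D (i - 1)))) j
  have hB0 : B 0 = Ico 0 1 := rfl
  have hB1 : B 1 = Ico 0 1 := by simp [B]
  have hBs : ∀ i, B (i + 2) = B (i + 1) \ floorSaturation (q (i + 2)) (D i) := by
    intro i; simp [B]
  have hBsub : ∀ i, B (i + 1) ⊆ B i := fun i => sdiff_subset
  clear_value B
  have hB01 : ∀ i, B i ⊆ Ico 0 1 := by
    intro i
    induction i with
    | zero => exact hB0.subset
    | succ i ih => exact (hBsub i).trans ih
  have hsat : ∀ i, FloorSaturated (q i) (B i) ∧ FloorSaturated (q (i + 1)) (B (i + 1)) := by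
    intro i
    induction i with
    | zero =>
      exact ⟨hB0 ▸ floorSaturated_Ico (hq 0), hB1 ▸ floorSaturated_Ico (hq 1)⟩
    | succ i ih =>
      refine ⟨ih.2, ?_⟩
      rw [hBs]
      exact (ih.2.of_dvd (hdvd _) (hq _)).diff (floorSaturated_floorSaturation _ _)
  have hfin : ∀ i, volume (B i) ≠ ⊤ := fun i =>
    ne_top_of_le_ne_top (by simp) (measure_mono (hB01 i))
  have hstep : ∀ i, volume.real (B (i + 1)) ≤ volume.real (B (i + 2)) +
      (1 / 8 * volume.real (B i) + (1 / 2) ^ i / 16) := by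
    intro i
    -- The loss is measured inside `B i`, not `B (i + 1)`: only `B i` is known to be saturated at
    -- the scale `q i` required by `hvol`.
    have h1 : B (i + 1) ⊆ B (i + 2) ∪ (B i ∩ F i) := by
      intro x hx
      rw [hBs]
      by_cases h : x ∈ floorSaturation (q (i + 2)) (D i)
      · obtain ⟨y, hy, hyx⟩ := h
        exact Or.inr ⟨hBsub i hx, hF i y x hy (abs_sub_lt_of_floor_mul_eq (hq _) hyx)⟩
      · exact Or.inl ⟨hx, h⟩
    have h2 : volume (B (i + 1)) ≤ volume (B (i + 2)) +
        (ENNReal.ofReal (1 / 8) * volume (B i) + ENNReal.ofReal ((1 / 2) ^ i / 16)) :=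
      ((measure_mono h1).trans (measure_union_le _ _)).trans
        (by gcongr; exact hvol i _ (hsat i).1)
    have h3 : ENNReal.ofReal (1 / 8) * volume (B i) ≠ ⊤ :=
      ENNReal.mul_ne_top ENNReal.ofReal_ne_top (hfin i)
    have h5 := ENNReal.add_ne_top.2
      ⟨h3, ENNReal.ofReal_ne_top (r := (1 / 2 : ℝ) ^ i / 16)⟩
    have h4 := ENNReal.toReal_mono (ENNReal.add_ne_top.2 ⟨hfin (i + 2), h5⟩) h2
    rw [ENNReal.toReal_add (hfin _) h5, ENNReal.toReal_add h3 (by simp),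
      ENNReal.toReal_mul, ENNReal.toReal_ofReal (by norm_num),
      ENNReal.toReal_ofReal (by positivity)] at h4
    exact h4
  have hgrow : ∀ i, volume.real (B i) ≤ 2 * volume.real (B (i + 1)) ∧
      (1 / 2 : ℝ) ^ i ≤ volume.real (B i) := by
    intro i
    induction i with
    | zero =>
      rw [zero_add, hB0, hB1]
      simp
    | succ i ih =>
      -- By induction the two losses are at most 1/4 and 1/8 of the measure of `B (i + 1)`, so more
      -- than half remains.
      have := hstep i
      obtain ⟨h1, h2⟩ := ih
      have h3 : (1 / 2 : ℝ) ^ (i + 1) = (1 / 2) ^ i / 2 := by ring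
      refine ⟨?_, by rw [h3]; linarith⟩
      rw [add_assoc, one_add_one_eq_two]
      linarith [measureReal_nonneg (μ := volume) (s := B (i + 1))]
  have hpos : 0 < volume.real (B (j + 1)) := (by positivity : (0:ℝ) < _).trans_le (hgrow (j + 1)).2
  obtain ⟨x, hx⟩ : (B (j + 1)).Nonempty := by
    by_contra h
    rw [not_nonempty_iff_eq_empty.1 h] at hpos
    simp at hpos
  refine ⟨x, hB01 (j + 1) hx, fun i hi hxi => ?_⟩
  have hanti : Antitone B := antitone_nat_of_succ_le hBsub
  have := hanti (show i + 2 ≤ j + 1 by omega) hx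
  rw [hBs] at this
  exact this.2 (subset_floorSaturation _ _ hxi)

/-! ### Avoiding balls, and Hausdorff dimension -/

theorem distNearestInt_le_add (x y : ℝ) : distNearestInt x ≤ distNearestInt y + |x - y| := by
  refine (round_le x (round y)).trans ?_
  rw [distNearestInt, add_comm]
  exact abs_sub_le x y _

theorem continuous_distNearestInt : Continuous distNearestInt := by
  refine (LipschitzWith.of_le_add (f := distNearestInt) fun x y => ?_).continuous
  rw [Real.dist_eq]
  exact distNearestInt_le_add x y

/-- If the forbidden sets `‖t k x‖ < δ k` split into windows adapted to the scales `1 / q j`, then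
they can be avoided together with any family of balls of small total `s`-dimensional size. -/
theorem exists_avoiding_balls {t δ : ℕ → ℝ} {W : ℕ → Finset ℕ} {q : ℕ → ℕ} {s : ℝ}
    (hs₀ : 0 < s) (hs₁ : s < 1) (hq : ∀ j, 0 < q j) (hdvd : ∀ j, q j ∣ q (j + 1))
    (hδ : ∀ k, 0 ≤ δ k) (hqt : ∀ j, ∀ k ∈ W j, (q j : ℝ) ≤ t k)
    (htq : ∀ j, ∀ k ∈ W j, t k ≤ δ k * q (j + 2))
    (hsum : ∀ j, ∑ k ∈ W j, δ k ≤ 1 / 96)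
    (hgrow : ∀ j, 64 * (2 : ℝ) ^ j ≤ (q (j + 1) : ℝ) ^ (1 - s)) :
    ∃ η : ℝ, 0 < η ∧ ∀ c ρ : ℕ → ℝ, (∀ n, 0 < ρ n) →
      ∑' n, ENNReal.ofReal (ρ n ^ s) ≤ ENNReal.ofReal η →
      ∃ α ∈ Icc (0 : ℝ) 1, (∀ j, ∀ k ∈ W j, δ k ≤ distNearestInt (t k * α)) ∧
        ∀ n, α ∉ Metric.ball (c n) (ρ n) := by
  have hq' : ∀ j, (0 : ℝ) < q j := fun j => by exact_mod_cast hq j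
  have hq1 : ∀ j, (1 : ℝ) ≤ q j := fun j => by exact_mod_cast hq j
  -- This η forces every radius below 1 / `q 1`, so every ball is assigned to some stage.
  refine ⟨(1 / (2 * q 1 : ℝ)) ^ s, Real.rpow_pos_of_pos (by have := hq' 1; positivity) _,
    fun c ρ hρ hη => ?_⟩
  set η : ℝ := (1 / (2 * q 1 : ℝ)) ^ s with hηdef
  have hη1 : η ≤ 1 := by
    refine Real.rpow_le_one (by have := hq' 1; positivity) ?_ hs₀.le
    rw [div_le_one (by have := hq' 1; positivity)]
    linarith [hq1 1]
  have hρ1 : ∀ n, ρ n < 1 / q 1 := by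
    intro n
    have h1 := (ENNReal.le_tsum n).trans hη
    rw [ENNReal.ofReal_le_ofReal_iff (by positivity), hηdef,
      Real.rpow_le_rpow_iff (hρ n).le (by have := hq' 1; positivity) hs₀] at h1
    refine h1.trans_lt (one_div_lt_one_div_of_lt (hq' 1) ?_)
    linarith [hq' 1]
  have hlevel : ∀ n, ∃ j, 1 / (q (j + 2) : ℝ) ≤ ρ n ∧ ρ n < 1 / (q (j + 1) : ℝ) := by
    intro n
    have hex : ∃ j, 1 / (q (j + 1) : ℝ) ≤ ρ n := by
      obtain ⟨j, hj⟩ := pow_unbounded_of_one_lt (1 / ρ n) (one_lt_two (α := ℝ))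
      refine ⟨j, ?_⟩
      rw [one_div_le (hq' _) (hρ n)]
      have h1 : (q (j + 1) : ℝ) ^ (1 - s) ≤ q (j + 1) := by
        calc (q (j + 1) : ℝ) ^ (1 - s) ≤ (q (j + 1) : ℝ) ^ (1 : ℝ) :=
              Real.rpow_le_rpow_of_exponent_le (hq1 _) (by linarith)
          _ = _ := Real.rpow_one _
      have h2 := hgrow j
      have h3 : (0 : ℝ) < 2 ^ j := by positivity
      linarith
    classical
    obtain ⟨i, hi⟩ : ∃ i, Nat.find hex = i + 1 := by
      refine Nat.exists_eq_succ_of_ne_zero fun h => ?_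
      have := Nat.find_spec hex
      rw [h] at this
      exact absurd (hρ1 n) (not_lt.2 this)
    refine ⟨i, ?_, ?_⟩
    · have := Nat.find_spec hex
      rwa [hi] at this
    · exact not_le.1 (Nat.find_min hex (show i < _ by omega))
  set P : ℕ → ℕ → Prop := fun j n =>
    1 / (q (j + 2) : ℝ) ≤ ρ n ∧ ρ n < 1 / (q (j + 1) : ℝ) with hP
  set D : ℕ → Set ℝ := fun j => (⋃ k ∈ W j, {x | distNearestInt (t k * x) < δ k}) ∪
    ⋃ n, {x | P j n ∧ x ∈ Metric.ball (c n) (ρ n)} with hD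
  -- Doubling absorbs a displacement below 1 / `q (j + 2)`, as t_k / `q (j + 2)` ≤ δ_k and 1 / `q (j
  -- + 2)` ≤ ρ_n.
  set F : ℕ → Set ℝ := fun j => (⋃ k ∈ W j, {x | distNearestInt (t k * x) ≤ 2 * δ k}) ∪
    ⋃ n, {x | P j n ∧ x ∈ Metric.ball (c n) (2 * ρ n)} with hFdef
  have hF : ∀ j x y, x ∈ D j → |x - y| < 1 / q (j + 2) → y ∈ F j := by
    rintro j x y (hx | hx) hxy
    · left
      simp only [mem_iUnion, mem_ofPred_eq] at hx ⊢
      obtain ⟨k, hk, hx⟩ := hx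
      refine ⟨k, hk, ?_⟩
      have ht : 0 < t k := (hq' j).trans_le (hqt j k hk)
      have h1 := distNearestInt_le_add (t k * y) (t k * x)
      rw [← mul_sub, abs_mul, abs_of_pos ht, abs_sub_comm] at h1
      have h2 : t k * |x - y| ≤ δ k :=
        calc t k * |x - y| ≤ (δ k * q (j + 2)) * (1 / q (j + 2)) :=
              mul_le_mul (htq j k hk) hxy.le (abs_nonneg _) (ht.le.trans (htq j k hk))
          _ = δ k := by have := hq' (j + 2); field_simp
      linarith
    · right
      simp only [mem_iUnion, mem_ofPred_eq] at hx ⊢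
      obtain ⟨n, hn, hx⟩ := hx
      refine ⟨n, hn, ?_⟩
      rw [Metric.mem_ball, Real.dist_eq] at hx ⊢
      have := abs_sub_le y x (c n)
      rw [abs_sub_comm y x] at this
      linarith [hn.1]
  have hvol : ∀ j S, FloorSaturated (q j) S →
      volume (S ∩ F j) ≤ ENNReal.ofReal (1 / 8) * volume S + ENNReal.ofReal ((1 / 2) ^ j / 16) := by
    intro j S hS
    rw [hFdef, inter_union_distrib_left]
    refine (measure_union_le _ _).trans (add_le_add ?_ ?_)
    · rw [inter_iUnion₂]
      calc volume (⋃ k ∈ W j, S ∩ {x | distNearestInt (t k * x) ≤ 2 * δ k})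
          ≤ ∑ k ∈ W j, volume (S ∩ {x | distNearestInt (t k * x) ≤ 2 * δ k}) :=
            measure_biUnion_finset_le _ _
        _ ≤ ∑ k ∈ W j, ENNReal.ofReal (6 * (2 * δ k)) * volume S :=
            Finset.sum_le_sum fun k hk => hS.volume_inter_distNearestInt_le (hq j)
              (by have := hδ k; positivity) (hqt j k hk)
        _ = ENNReal.ofReal (∑ k ∈ W j, 6 * (2 * δ k)) * volume S := by
            rw [← Finset.sum_mul, ENNReal.ofReal_sum_of_nonneg]
            intro k _
            have := hδ k
            positivity
        _ ≤ ENNReal.ofReal (1 / 8) * volume S := by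
            gcongr
            rw [← Finset.mul_sum, ← Finset.mul_sum]
            linarith [hsum j]
    · calc volume (S ∩ ⋃ n, {x | P j n ∧ x ∈ Metric.ball (c n) (2 * ρ n)})
          ≤ ∑' n, volume {x | P j n ∧ x ∈ Metric.ball (c n) (2 * ρ n)} :=
            (measure_mono inter_subset_right).trans (measure_iUnion_le _)
        _ ≤ ∑' n, ENNReal.ofReal ((1 / 2) ^ j / 16) * ENNReal.ofReal (ρ n ^ s) := by
            refine ENNReal.tsum_le_tsum fun n => ?_
            by_cases hn : P j n
            · simp only [hn, true_and, ofPred_mem_eq]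
              rw [Real.volume_ball, ← ENNReal.ofReal_mul (by positivity)]
              refine ENNReal.ofReal_le_ofReal ?_
              have h1 : ρ n = ρ n ^ (1 - s) * ρ n ^ s := by
                rw [← Real.rpow_add (hρ n)]
                simp
              have h2 : ρ n ^ (1 - s) ≤ 1 / (q (j + 1) : ℝ) ^ (1 - s) := by
                refine (Real.rpow_le_rpow (hρ n).le hn.2.le (by linarith)).trans_eq ?_
                rw [Real.div_rpow zero_le_one (hq' _).le, Real.one_rpow]
              have h3 : 1 / (q (j + 1) : ℝ) ^ (1 - s) ≤ 1 / (64 * (2 : ℝ) ^ j) :=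
                one_div_le_one_div_of_le (by positivity) (hgrow j)
              have h4 : 0 < ρ n ^ s := Real.rpow_pos_of_pos (hρ n) _
              calc 2 * (2 * ρ n) = 4 * (ρ n ^ (1 - s) * ρ n ^ s) := by rw [← h1]; ring
                _ ≤ 4 * (1 / (64 * (2 : ℝ) ^ j) * ρ n ^ s) := by
                    gcongr
                    exact h2.trans h3
                _ = (1 / 2) ^ j / 16 * ρ n ^ s := by
                    rw [div_pow, one_pow]; field_simp; ring
            · simp [hn]
        _ = ENNReal.ofReal ((1 / 2) ^ j / 16) * ∑' n, ENNReal.ofReal (ρ n ^ s) :=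
            ENNReal.tsum_mul_left
        _ ≤ ENNReal.ofReal ((1 / 2) ^ j / 16) * 1 := by
            gcongr
            exact hη.trans (by simpa using ENNReal.ofReal_le_ofReal hη1)
        _ = _ := mul_one _
  have hDopen : ∀ i, IsOpen (D i) := by
    intro i
    refine IsOpen.union (isOpen_biUnion fun k _ => ?_) (isOpen_iUnion fun n => ?_)
    · exact isOpen_lt (continuous_distNearestInt.comp (continuous_const_mul _)) continuous_const
    · exact isOpen_const.and Metric.isOpen_ball
  -- The sets `D i` are open, so compactness turns the finite stages into one point avoiding all of
  -- them.
  obtain ⟨α, hα⟩ : (⋂ j : ℕ, (Icc (0 : ℝ) 1 ∩ ⋂ i < j, (D i)ᶜ)).Nonempty := by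
    have hcl : ∀ j : ℕ, IsClosed (⋂ i < j, (D i)ᶜ) := fun j =>
      isClosed_biInter fun i _ => (hDopen i).isClosed_compl
    refine IsCompact.nonempty_iInter_of_sequence_nonempty_isCompact_isClosed _ (fun j => ?_)
      (fun j => ?_) (isCompact_Icc.inter_right (hcl 0)) fun j => isClosed_Icc.inter (hcl j)
    · exact inter_subset_inter_right _ (biInter_subset_biInter_left fun i hi => Nat.lt_succ_of_lt hi)
    · obtain ⟨x, hx, hxD⟩ := exists_forall_lt_notMem q hq hdvd D F hF hvol j
      exact ⟨x, Ico_subset_Icc_self hx, mem_iInter₂.2 hxD⟩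
  rw [mem_iInter] at hα
  have hαD : ∀ j, α ∉ D j := fun j => mem_iInter₂.1 (hα (j + 1)).2 j (Nat.lt_succ_self j)
  refine ⟨α, (hα 0).1, fun j k hk => ?_, fun n hn => ?_⟩
  · by_contra! h
    exact hαD j (Or.inl (mem_biUnion (x := k) hk h))
  · obtain ⟨j, hj⟩ := hlevel n
    exact hαD j (Or.inr (mem_iUnion.2 ⟨n, hj, hn⟩))

/-- A set that is not covered by any family of balls of small total `s`-dimensional size has
Hausdorff dimension at least `s`. -/
theorem le_dimH_of_exists_avoiding_balls {E : Set ℝ} {s : ℝ≥0} (hs : 0 < s) {η : ℝ} (hη : 0 < η)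
    (h : ∀ c ρ : ℕ → ℝ, (∀ n, 0 < ρ n) →
      ∑' n, ENNReal.ofReal (ρ n ^ (s : ℝ)) ≤ ENNReal.ofReal η →
      ∃ α ∈ E, ∀ n, α ∉ Metric.ball (c n) (ρ n)) : (s : ℝ≥0∞) ≤ dimH E := by
  have hs' : (0 : ℝ) < s := hs
  refine le_dimH_of_hausdorffMeasure_ne_zero fun h0 => ?_
  rw [Measure.hausdorffMeasure_apply] at h0
  simp only [ENNReal.iSup_eq_zero] at h0
  have hlt := (h0 1 one_pos).trans_lt
    (show (0 : ℝ≥0∞) < ENNReal.ofReal (η / 2) by simpa using hη)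
  simp only [iInf_lt_iff] at hlt
  obtain ⟨T, hT, hT1, hsum⟩ := hlt
  obtain ⟨ε, hε, hεsum⟩ := ENNReal.exists_pos_sum_of_countable
    (show ENNReal.ofReal (η / 2) ≠ 0 by simpa using hη) ℕ
  have hbase : ∀ n, 0 < Metric.diam (T n) ^ (s : ℝ) + ε n := fun n =>
    add_pos_of_nonneg_of_pos (Real.rpow_nonneg Metric.diam_nonneg _) (hε n)
  have hfin : ∀ n, Metric.ediam (T n) ≠ ∞ := fun n =>
    ne_top_of_le_ne_top ENNReal.one_ne_top (hT1 n)
  classical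
  -- The added ε makes each radius positive and larger than the diameter, so the open ball contains
  -- the covering set; its cost is at most η / 2.
  obtain ⟨α, hα, hαn⟩ := h (fun n => if hn : (T n).Nonempty then hn.some else 0)
    (fun n => (Metric.diam (T n) ^ (s : ℝ) + ε n) ^ (1 / s : ℝ))
    (fun n => Real.rpow_pos_of_pos (hbase n) _) (by
      calc ∑' n, ENNReal.ofReal (((Metric.diam (T n) ^ (s : ℝ) + ε n) ^ (1 / s : ℝ)) ^ (s : ℝ))
          = ∑' n, ((⨆ _ : (T n).Nonempty, Metric.ediam (T n) ^ (s : ℝ)) + ε n) := by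
            refine tsum_congr fun n => ?_
            rw [← Real.rpow_mul (hbase n).le, one_div_mul_cancel hs'.ne', Real.rpow_one,
              ENNReal.ofReal_add (Real.rpow_nonneg Metric.diam_nonneg _) (ε n).coe_nonneg,
              ENNReal.ofReal_coe_nnreal]
            congr 1
            rcases (T n).eq_empty_or_nonempty with hn | hn
            · simp [hn, hs'.ne']
            · rw [ciSup_pos hn, ← ENNReal.ofReal_rpow_of_nonneg Metric.diam_nonneg hs'.le,
                Metric.diam, ENNReal.ofReal_toReal (hfin n)]
        _ = _ := ENNReal.tsum_add
        _ ≤ ENNReal.ofReal (η / 2) + ENNReal.ofReal (η / 2) := add_le_add hsum.le hεsum.le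
        _ = ENNReal.ofReal η := by
            rw [← ENNReal.ofReal_add (by positivity) (by positivity), add_halves])
  obtain ⟨n, hn⟩ := mem_iUnion.1 (hT hα)
  refine hαn n ?_
  have hne : (T n).Nonempty := ⟨α, hn⟩
  rw [dif_pos hne, Metric.mem_ball]
  calc dist α hne.some ≤ Metric.diam (T n) :=
        Metric.dist_le_diam_of_mem (Metric.isBounded_iff_ediam_ne_top.2 (hfin n)) hn hne.some_mem
    _ = (Metric.diam (T n) ^ (s : ℝ)) ^ (1 / s : ℝ) := by
        rw [← Real.rpow_mul Metric.diam_nonneg, mul_one_div_cancel hs'.ne', Real.rpow_one]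
    _ < _ := Real.rpow_lt_rpow (Real.rpow_nonneg Metric.diam_nonneg _)
        (by linarith [show (0 : ℝ) < ε n from hε n]) (by positivity)

/-! ### Windows and their growth -/

/-- The lower bound is Bernoulli's inequality for exponents in [0, 1]; the upper one is
subadditivity of the power. -/
theorem rpow_sub_one_rpow_bounds {β : ℝ} (hβ₀ : 0 < β) (hβ₁ : β < 1) {x : ℝ} (hx : 1 ≤ x) :
    β * x ^ (β - 1) ≤ x ^ β - (x - 1) ^ β ∧ x ^ β - (x - 1) ^ β ≤ 1 := by
  have hx0 : 0 < x := by linarith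
  constructor
  · have h1 : (1 + -(1 / x)) ^ β ≤ 1 + β * -(1 / x) := by
      refine rpow_one_add_le_one_add_mul_self ?_ hβ₀.le hβ₁.le
      rw [neg_le_neg_iff, div_le_one hx0]
      exact hx
    have h2 : (x - 1) ^ β = x ^ β * (1 + -(1 / x)) ^ β := by
      rw [← Real.mul_rpow hx0.le]
      · congr 1
        field_simp
        ring
      · rw [← sub_eq_add_neg, sub_nonneg, div_le_one hx0]
        exact hx
    have h3 : x ^ (β - 1) = x ^ β / x := by rw [Real.rpow_sub hx0, Real.rpow_one]
    rw [h2, h3]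
    have h4 : 0 < x ^ β := Real.rpow_pos_of_pos hx0 _
    calc β * (x ^ β / x) = x ^ β - x ^ β * (1 + β * -(1 / x)) := by field_simp; ring
      _ ≤ _ := by gcongr
  · have := Real.rpow_add_le_add_rpow (show 0 ≤ x - 1 by linarith) zero_le_one hβ₀.le hβ₁.le
    rw [sub_add_cancel, Real.one_rpow] at this
    linarith

theorem sum_rpow_sub_one_le {β u v : ℝ} (hβ₀ : 0 < β) (hβ₁ : β < 1) (huv : u ≤ v) {W : Finset ℕ}
    (hW : ∀ k ∈ W, 1 ≤ k ∧ u < (k : ℝ) ^ β ∧ (k : ℝ) ^ β ≤ v) :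
    ∑ k ∈ W, β * (k : ℝ) ^ (β - 1) ≤ v - u + 1 := by
  -- Clamping to [u - 1, v] keeps the increments at indices of `W`, since k^β grows by at most 1 per
  -- step, and bounds the telescoped sum.
  set h : ℕ → ℝ := fun k => min (max ((k : ℝ) ^ β) (u - 1)) v with hh
  have hmono : Monotone h := by
    intro a b hab
    have : (a : ℝ) ^ β ≤ (b : ℝ) ^ β :=
      Real.rpow_le_rpow (Nat.cast_nonneg _) (by exact_mod_cast hab) hβ₀.le
    exact min_le_min_right _ (max_le_max_right _ this)
  obtain ⟨N, hN⟩ := W.bddAbove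
  calc ∑ k ∈ W, β * (k : ℝ) ^ (β - 1) ≤ ∑ k ∈ W, (h k - h (k - 1)) := by
        refine Finset.sum_le_sum fun k hk => ?_
        obtain ⟨hk1, hku, hkv⟩ := hW k hk
        have hb := rpow_sub_one_rpow_bounds hβ₀ hβ₁ (x := k) (by exact_mod_cast hk1)
        have hle : ((k : ℝ) - 1) ^ β ≤ (k : ℝ) ^ β :=
          Real.rpow_le_rpow (by simpa using hk1) (by linarith) hβ₀.le
        simp only [hh]
        rw [Nat.cast_sub hk1, Nat.cast_one, max_eq_left (by linarith), min_eq_left hkv,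
          max_eq_left (by linarith), min_eq_left (hle.trans hkv)]
        exact hb.1
    _ ≤ ∑ k ∈ Finset.range (N + 1), (h k - h (k - 1)) := by
        refine Finset.sum_le_sum_of_subset_of_nonneg (fun k hk => ?_) fun k _ _ => ?_
        · exact Finset.mem_range.2 (Nat.lt_succ_of_le (hN hk))
        · exact sub_nonneg.2 (hmono (Nat.sub_le _ _))
    _ = h N - h 0 := by
        rw [Finset.sum_range_succ']
        simp only [Nat.add_sub_cancel, Nat.zero_sub, sub_self, add_zero]
        exact Finset.sum_range_sub h N
    _ ≤ v - u + 1 := by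
        have h1 : h N ≤ v := min_le_right _ _
        have h2 : u - 1 ≤ h 0 := le_min (le_max_right _ _) (by linarith)
        linarith

/-- The exponents `C m log m` separating consecutive windows. -/
noncomputable def windowExponent (C : ℝ) (m : ℕ) : ℝ := C * (m * Real.log m)

theorem windowExponent_mono {C : ℝ} (hC : 0 < C) : Monotone (windowExponent C) := by
  refine monotone_nat_of_le_succ fun m => ?_
  unfold windowExponent
  rcases m.eq_zero_or_pos with rfl | hm
  · simp
  · have h1 : Real.log m ≤ Real.log (m + 1 : ℕ) :=
      Real.log_le_log (by exact_mod_cast hm) (by push_cast; linarith)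
    have h2 : 0 ≤ Real.log m := Real.log_natCast_nonneg _
    gcongr
    omega

theorem add_log_le_windowExponent_succ {C : ℝ} (hC : 0 < C) {m : ℕ} (hm : 0 < m) :
    windowExponent C m + C * Real.log m ≤ windowExponent C (m + 1) := by
  have h1 : Real.log m ≤ Real.log (m + 1 : ℕ) :=
    Real.log_le_log (by exact_mod_cast hm) (by push_cast; linarith)
  unfold windowExponent
  calc C * (m * Real.log m) + C * Real.log m = C * (((m + 1 : ℕ) : ℝ) * Real.log m) := by
        push_cast; ring
    _ ≤ _ := by gcongr

theorem one_le_log_natCast {m : ℕ} (hm : 3 ≤ m) : 1 ≤ Real.log m := by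
  rw [Real.le_log_iff_exp_le (by positivity)]
  have : (3 : ℝ) ≤ m := by exact_mod_cast hm
  linarith [Real.exp_one_lt_three]

theorem windowExponent_succ_le {C : ℝ} (hC : 0 < C) {m : ℕ} (hm : 3 ≤ m) :
    windowExponent C (m + 1) ≤ windowExponent C m + 3 * C * Real.log m := by
  have hm0 : (0 : ℝ) < m := by positivity
  have hm3 : (3 : ℝ) ≤ m := by exact_mod_cast hm
  have h1 := one_le_log_natCast hm
  have h2 : Real.log (m + 1) ≤ Real.log m + 1 / m := by
    have : Real.log (m + 1) = Real.log m + Real.log (1 + 1 / m) := by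
      rw [← Real.log_mul hm0.ne' (by positivity)]
      congr 1
      field_simp
    rw [this]
    have := Real.log_le_sub_one_of_pos (show (0 : ℝ) < 1 + 1 / m by positivity)
    linarith
  have h3 : 1 / (m : ℝ) ≤ 1 := by rw [div_le_one hm0]; linarith
  have h4 : (m + 1 : ℝ) * Real.log (m + 1) ≤ m * Real.log m + 3 * Real.log m := by
    calc (m + 1 : ℝ) * Real.log (m + 1) ≤ (m + 1) * (Real.log m + 1 / m) := by gcongr
      _ = m * Real.log m + Real.log m + 1 + 1 / m := by field_simp; ring
      _ ≤ _ := by linarith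
  unfold windowExponent
  push_cast
  calc C * ((m + 1 : ℝ) * Real.log (m + 1)) ≤ C * (m * Real.log m + 3 * Real.log m) := by gcongr
    _ = _ := by ring

theorem tendsto_log_natCast : Tendsto (fun m : ℕ => Real.log m) atTop atTop :=
  Real.tendsto_log_atTop.comp tendsto_natCast_atTop_atTop

theorem tendsto_windowExponent {C : ℝ} (hC : 0 < C) : Tendsto (windowExponent C) atTop atTop :=
  (tendsto_natCast_atTop_atTop.atTop_mul_atTop₀ tendsto_log_natCast).const_mul_atTop hC

/-- With C = 5/β one step gains a factor m^(5/β), while u_m ≤ C m² makes the left-hand power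
O(m^(4/β)); the spare m^(1/β) absorbs the constants. -/
theorem eventually_exp_windowExponent_succ_ge {β A : ℝ} (hβ : 0 < β) (hA : 0 < A) :
    ∀ᶠ m : ℕ in atTop, A * Real.exp (windowExponent (5 / β) m) *
      windowExponent (5 / β) m ^ (2 / β) ≤ Real.exp (windowExponent (5 / β) (m + 1)) := by
  have hlim : Tendsto (fun m : ℕ => (m : ℝ) ^ (1 / β)) atTop atTop :=
    (tendsto_rpow_atTop (by positivity)).comp tendsto_natCast_atTop_atTop
  filter_upwards [hlim.eventually_ge_atTop (A * (5 / β) ^ (2 / β)), eventually_ge_atTop 3]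
    with m hm hm3
  have hm0 : (0 : ℝ) < m := by positivity
  have hlog : 0 ≤ Real.log m := Real.log_natCast_nonneg _
  have h1 : windowExponent (5 / β) m ^ (2 / β) ≤ (5 / β) ^ (2 / β) * (m : ℝ) ^ (4 / β) := by
    have : (m : ℝ) ^ (4 / β) = ((m : ℝ) ^ (2 : ℝ)) ^ (2 / β) := by
      rw [← Real.rpow_mul hm0.le]
      congr 1
      ring
    rw [this, ← Real.mul_rpow (by positivity) (by positivity)]
    refine Real.rpow_le_rpow (by unfold windowExponent; positivity) ?_ (by positivity)
    unfold windowExponent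
    rw [Real.rpow_two, sq]
    gcongr
    exact Real.log_le_self hm0.le
  calc A * Real.exp (windowExponent (5 / β) m) * windowExponent (5 / β) m ^ (2 / β)
      ≤ A * Real.exp (windowExponent (5 / β) m) * ((5 / β) ^ (2 / β) * (m : ℝ) ^ (4 / β)) := by
        gcongr
    _ = Real.exp (windowExponent (5 / β) m) * ((A * (5 / β) ^ (2 / β)) * (m : ℝ) ^ (4 / β)) := by
        ring
    _ ≤ Real.exp (windowExponent (5 / β) m) * ((m : ℝ) ^ (1 / β) * (m : ℝ) ^ (4 / β)) := by
        gcongr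
    _ = Real.exp (windowExponent (5 / β) m + 5 / β * Real.log m) := by
        rw [← Real.rpow_add hm0, Real.exp_add, Real.rpow_def_of_pos hm0]
        congr 2
        ring
    _ ≤ _ := Real.exp_le_exp.2 (add_log_le_windowExponent_succ (by positivity) (by omega))

theorem eventually_two_pow_le_exp_windowExponent {C γ r : ℝ} (hC : 0 < C) (hγ : 0 < γ)
    (hr : 0 < r) :
    ∀ᶠ m : ℕ in atTop, 64 * (2 : ℝ) ^ m ≤ (γ * Real.exp (windowExponent C m)) ^ r := by
  have hγr : 0 < γ ^ r := Real.rpow_pos_of_pos hγ _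
  have hexp : Tendsto (fun m : ℕ => Real.exp m) atTop atTop :=
    Real.tendsto_exp_atTop.comp tendsto_natCast_atTop_atTop
  filter_upwards [(tendsto_log_natCast.const_mul_atTop (mul_pos hC hr)).eventually_ge_atTop 2,
    hexp.eventually_ge_atTop (64 / γ ^ r)] with m h1 h2
  rw [Real.mul_rpow hγ.le (Real.exp_pos _).le, ← Real.exp_mul]
  have h3 : (2 : ℝ) * m ≤ windowExponent C m * r := by
    unfold windowExponent
    calc (2 : ℝ) * m ≤ (C * r * Real.log m) * m := by gcongr
      _ = _ := by ring
  have h4 : (2 : ℝ) ^ m ≤ Real.exp m := by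
    have : (2 : ℝ) ≤ Real.exp 1 := by linarith [Real.add_one_le_exp (1 : ℝ)]
    calc (2 : ℝ) ^ m ≤ Real.exp 1 ^ m := by gcongr
      _ = Real.exp m := by rw [← Real.exp_nat_mul, mul_one]
  rw [div_le_iff₀' hγr] at h2
  calc 64 * (2 : ℝ) ^ m ≤ (γ ^ r * Real.exp m) * Real.exp m := by gcongr
    _ = γ ^ r * Real.exp (2 * m) := by rw [mul_assoc, ← Real.exp_add, two_mul]
    _ ≤ _ := by gcongr

/-- A real number at least `1` is within a factor `2` of a power of `2` below it. -/
theorem two_pow_log_floor_bounds {x : ℝ} (hx : 1 ≤ x) :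
    ((2 ^ Nat.log 2 ⌊x⌋₊ : ℕ) : ℝ) ≤ x ∧ x / 2 ≤ ((2 ^ Nat.log 2 ⌊x⌋₊ : ℕ) : ℝ) := by
  have hne : ⌊x⌋₊ ≠ 0 := (Nat.floor_pos.2 hx).ne'
  constructor
  · exact (Nat.cast_le.2 (Nat.pow_log_le_self 2 hne)).trans (Nat.floor_le (by linarith))
  · have h1 : ⌊x⌋₊ + 1 ≤ 2 ^ Nat.log 2 ⌊x⌋₊ * 2 := by
      rw [← pow_succ]
      exact Nat.lt_pow_succ_log_self one_lt_two _
    have h2 : ((⌊x⌋₊ : ℝ) + 1) ≤ ((2 ^ Nat.log 2 ⌊x⌋₊ : ℕ) : ℝ) * 2 := by exact_mod_cast h1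
    linarith [Nat.lt_floor_add_one x]

/-! ### From eventual to uniform bounds -/

theorem countable_setOf_distNearestInt_eq_zero {t : ℕ → ℝ} (ht : ∀ n, 1 ≤ n → 0 < t n) :
    {α : ℝ | ∃ n, 1 ≤ n ∧ distNearestInt (t n * α) = 0}.Countable := by
  refine (countable_range fun p : ℕ × ℤ => (p.2 : ℝ) / t p.1).mono ?_
  rintro α ⟨n, hn, h⟩
  refine ⟨(n, round (t n * α)), ?_⟩
  rw [distNearestInt, abs_eq_zero, sub_eq_zero] at h
  have := ht n hn
  simp only
  rw [← h]
  field_simp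

theorem distNearestInt_nonneg (x : ℝ) : 0 ≤ distNearestInt x := abs_nonneg _

/-- A sequence positive from index `1` on and eventually at least `κ > 0` has a positive strict
lower bound from index `1` on. -/
theorem exists_pos_forall_lt {f : ℕ → ℝ} (hf : ∀ n, 1 ≤ n → 0 < f n) {κ : ℝ} (hκ : 0 < κ)
    (h : ∀ᶠ n in atTop, κ ≤ f n) : ∃ ε, 0 < ε ∧ ∀ n, 1 ≤ n → ε < f n := by
  obtain ⟨N, hN⟩ := eventually_atTop.1 h
  have key : ∀ M : ℕ, ∃ ε, 0 < ε ∧ ∀ n, 1 ≤ n → n < M → ε < f n := by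
    intro M
    induction M with
    | zero => exact ⟨1, one_pos, fun n _ hn => absurd hn (Nat.not_lt_zero n)⟩
    | succ M ih =>
      obtain ⟨ε, hε, hεf⟩ := ih
      rcases M.eq_zero_or_pos with rfl | hM
      · exact ⟨1, one_pos, fun n h1 h2 => by omega⟩
      · have hM' := hf M hM
        refine ⟨min ε (f M / 2), lt_min hε (by positivity), fun n h1 h2 => ?_⟩
        rcases Nat.lt_succ_iff_lt_or_eq.1 h2 with h3 | rfl
        · exact (min_le_left _ _).trans_lt (hεf n h1 h3)
        · exact (min_le_right _ _).trans_lt (by linarith)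
  obtain ⟨ε, hε, hεf⟩ := key N
  refine ⟨min ε (κ / 2), lt_min hε (by positivity), fun n hn => ?_⟩
  rcases lt_or_ge n N with h1 | h1
  · exact (min_le_left _ _).trans_lt (hεf n hn h1)
  · exact (min_le_right _ _).trans_lt (by linarith [hN n h1])

/-! ### Assembly -/

/-- For each `s < 1` there is a constant `κ` for which the points satisfying the inequality for all
large `n` form a set of dimension at least `s`. -/
theorem exists_le_dimH_eventually {t : ℕ → ℝ} {β γ₁ γ₂ : ℝ}
    (hβ₀ : 0 < β) (hβ₁ : β < 1) (hγ₁ : 0 < γ₁) (hγ₂ : 0 < γ₂)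
    (ht : ∀ n : ℕ, 1 ≤ n →
      γ₁ * Real.exp ((n : ℝ) ^ β) ≤ t n ∧ t n ≤ γ₂ * Real.exp ((n : ℝ) ^ β))
    {s : ℝ≥0} (hs₀ : 0 < s) (hs₁ : s < 1) :
    ∃ κ : ℝ, 0 < κ ∧ (s : ℝ≥0∞) ≤ dimH {α : ℝ | α ∈ Icc (0 : ℝ) 1 ∧ ∀ᶠ n : ℕ in atTop,
      κ / ((n : ℝ) ^ (1 - β) * Real.log ((n : ℝ) + 1)) ≤ distNearestInt (t n * α)} := by
  have hs₁' : (s : ℝ) < 1 := hs₁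
  set C : ℝ := 5 / β with hCdef
  have hC : 0 < C := by positivity
  -- A window has Σ β k^(β-1) ≤ (3C + 1) log m, so this κ gives Σ δ_k ≤ 1/96.
  set κ : ℝ := 1 / (96 * (3 * C + 1)) with hκdef
  have hκ : 0 < κ := by positivity
  refine ⟨κ, hκ, ?_⟩
  set u := windowExponent C with hu
  have hmono : Monotone u := windowExponent_mono hC
  have hulim : Tendsto u atTop atTop := tendsto_windowExponent hC
  obtain ⟨J, hJ⟩ := eventually_atTop.1
    ((eventually_exp_windowExponent_succ_ge hβ₀
      (show 0 < 2 * γ₂ / (κ * γ₁) by positivity)).and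
    ((eventually_two_pow_le_exp_windowExponent hC (show 0 < γ₁ / 2 by positivity)
      (show 0 < 1 - (s : ℝ) by linarith)).and
    ((((Real.tendsto_exp_atTop.comp hulim).const_mul_atTop hγ₁).eventually_ge_atTop 1).and
    (((tendsto_log_natCast.const_mul_atTop hC).eventually_ge_atTop 1).and
    (eventually_ge_atTop 3)))))
  simp only [Function.comp_apply] at hJ
  -- Powers of 2 make divisibility automatic, at the price of a factor 2 in size.
  set q : ℕ → ℕ := fun j => 2 ^ Nat.log 2 ⌊γ₁ * Real.exp (u (j + J))⌋₊ with hq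
  have hqle : ∀ j, (q j : ℝ) ≤ γ₁ * Real.exp (u (j + J)) := fun j =>
    (two_pow_log_floor_bounds (hJ (j + J) (by omega)).2.2.1).1
  have hqge : ∀ j, γ₁ / 2 * Real.exp (u (j + J)) ≤ q j := fun j => by
    have := (two_pow_log_floor_bounds (hJ (j + J) (by omega)).2.2.1).2
    rwa [mul_div_right_comm] at this
  set δ : ℕ → ℝ := fun n => κ / ((n : ℝ) ^ (1 - β) * Real.log ((n : ℝ) + 1)) with hδdef
  set W : ℕ → Finset ℕ := fun j => (Finset.range (⌊u (j + J + 1) ^ (1 / β)⌋₊ + 1)).filter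
    fun k => u (j + J) < (k : ℝ) ^ β ∧ (k : ℝ) ^ β ≤ u (j + J + 1) with hWdef
  have hu0 : ∀ m, 0 ≤ u m := fun m => by
    have := Real.log_natCast_nonneg m
    simp only [hu, windowExponent]
    positivity
  have hW : ∀ j k, k ∈ W j ↔ u (j + J) < (k : ℝ) ^ β ∧ (k : ℝ) ^ β ≤ u (j + J + 1) := by
    intro j k
    rw [hWdef, Finset.mem_filter, Finset.mem_range, Nat.lt_succ_iff]
    refine ⟨fun h => h.2, fun h => ⟨Nat.le_floor ?_, h⟩⟩
    rw [← Real.rpow_le_rpow_iff (Nat.cast_nonneg k) (Real.rpow_nonneg (hu0 _) _) hβ₀,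
      ← Real.rpow_mul (hu0 _), one_div_mul_cancel hβ₀.ne', Real.rpow_one]
    exact h.2
  have hW1 : ∀ j, ∀ k ∈ W j, 1 ≤ k := by
    intro j k hk
    rw [hW] at hk
    by_contra! h
    obtain rfl : k = 0 := by omega
    rw [Nat.cast_zero, Real.zero_rpow hβ₀.ne'] at hk
    exact absurd (hu0 (j + J)) (not_le.2 hk.1)
  have hlogpos : ∀ k : ℕ, 1 ≤ k → 0 < Real.log ((k : ℝ) + 1) := fun k hk => by
    have : (1 : ℝ) ≤ k := by exact_mod_cast hk
    exact Real.log_pos (by linarith)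
  have hδ0 : ∀ k, 0 ≤ δ k := fun k => by
    have : 0 ≤ Real.log ((k : ℝ) + 1) := Real.log_nonneg (by linarith [Nat.cast_nonneg (α := ℝ) k])
    simp only [hδdef]
    positivity
  have htq : ∀ j, ∀ k ∈ W j, t k ≤ δ k * q (j + 2) := by
    intro j k hk
    have hk1 := hW1 j k hk
    have hk1' : (1 : ℝ) ≤ k := by exact_mod_cast hk1
    have hk0 : (0 : ℝ) < k := by linarith
    have hlog := hlogpos k hk1
    rw [hW] at hk
    have hden : (k : ℝ) ^ (1 - β) * Real.log ((k : ℝ) + 1) ≤ u (j + J + 1) ^ (2 / β) := by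
      have h1 : (k : ℝ) ^ (1 - β) ≤ k := by
        simpa using Real.rpow_le_rpow_of_exponent_le hk1' (show 1 - β ≤ 1 by linarith)
      have h2 : Real.log ((k : ℝ) + 1) ≤ k := by
        linarith [Real.log_le_sub_one_of_pos (show (0 : ℝ) < k + 1 by linarith)]
      calc (k : ℝ) ^ (1 - β) * Real.log ((k : ℝ) + 1) ≤ k * k := by gcongr
        _ = ((k : ℝ) ^ β) ^ (2 / β) := by
            rw [← Real.rpow_mul hk0.le, mul_div_cancel₀ _ hβ₀.ne', Real.rpow_two, sq]
        _ ≤ _ := by gcongr; exact hk.2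
    have h3 := (hJ (j + J + 1) (by omega)).1
    have h4 := hqge (j + 2)
    rw [show j + 2 + J = j + J + 1 + 1 by ring] at h4
    have hd : 0 < (k : ℝ) ^ (1 - β) * Real.log ((k : ℝ) + 1) := by positivity
    simp only [hδdef]
    rw [div_mul_eq_mul_div, le_div_iff₀ hd]
    calc t k * ((k : ℝ) ^ (1 - β) * Real.log ((k : ℝ) + 1))
        ≤ (γ₂ * Real.exp (u (j + J + 1))) * u (j + J + 1) ^ (2 / β) := by
          refine mul_le_mul ((ht k hk1).2.trans ?_) hden hd.le (by positivity)
          gcongr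
          exact hk.2
      _ = κ * γ₁ / 2 * (2 * γ₂ / (κ * γ₁) * Real.exp (u (j + J + 1)) *
            u (j + J + 1) ^ (2 / β)) := by
          field_simp
      _ ≤ κ * γ₁ / 2 * Real.exp (u (j + J + 1 + 1)) := by gcongr
      _ = κ * (γ₁ / 2 * Real.exp (u (j + J + 1 + 1))) := by ring
      _ ≤ _ := by gcongr
  have hsum : ∀ j, ∑ k ∈ W j, δ k ≤ 1 / 96 := by
    intro j
    have hm := hJ (j + J) (by omega)
    have hm3 : 3 ≤ j + J := hm.2.2.2.2
    have hm0 : (0 : ℝ) < (j + J : ℕ) := by exact_mod_cast (show 0 < j + J by omega)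
    have hlm := one_le_log_natCast hm3
    have hule : ((j + J : ℕ) : ℝ) ≤ u (j + J) := by
      calc ((j + J : ℕ) : ℝ) = (j + J : ℕ) * 1 := (mul_one _).symm
        _ ≤ (j + J : ℕ) * (C * Real.log (j + J : ℕ)) := by
            gcongr
            exact hm.2.2.2.1
        _ = u (j + J) := by rw [hu, windowExponent]; ring
    have hδle : ∀ k ∈ W j, δ k ≤ κ / Real.log (j + J : ℕ) * (β * (k : ℝ) ^ (β - 1)) := by
      intro k hk
      have hk1 := hW1 j k hk
      have hk0 : (0 : ℝ) < k := by exact_mod_cast hk1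
      rw [hW] at hk
      -- Here k^β > u_m ≥ m, so log(k + 1) in δ_k may be traded for log m up to the factor β.
      have h1 : Real.log (j + J : ℕ) ≤ β * Real.log ((k : ℝ) + 1) := by
        calc Real.log (j + J : ℕ) ≤ Real.log ((k : ℝ) ^ β) :=
              Real.log_le_log hm0 (hule.trans hk.1.le)
          _ = β * Real.log k := Real.log_rpow hk0 _
          _ ≤ _ := by gcongr; linarith
      have h2 : (k : ℝ) ^ (β - 1) = ((k : ℝ) ^ (1 - β))⁻¹ := by
        rw [← Real.rpow_neg hk0.le, neg_sub]
      have h3 := hlogpos k hk1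
      have h4 : 0 < (k : ℝ) ^ (1 - β) := Real.rpow_pos_of_pos hk0 _
      simp only [hδdef]
      rw [h2, ← div_eq_mul_inv, div_mul_div_comm, div_le_div_iff₀ (by positivity) (by positivity)]
      calc κ * (Real.log (j + J : ℕ) * (k : ℝ) ^ (1 - β))
          ≤ κ * ((β * Real.log ((k : ℝ) + 1)) * (k : ℝ) ^ (1 - β)) := by gcongr
        _ = _ := by ring
    calc ∑ k ∈ W j, δ k ≤ κ / Real.log (j + J : ℕ) * ∑ k ∈ W j, β * (k : ℝ) ^ (β - 1) := by
          rw [Finset.mul_sum]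
          exact Finset.sum_le_sum hδle
      _ ≤ κ / Real.log (j + J : ℕ) * ((3 * C + 1) * Real.log (j + J : ℕ)) := by
          gcongr
          have h1 := sum_rpow_sub_one_le hβ₀ hβ₁ (hmono (Nat.le_succ (j + J)))
            (fun k hk => ⟨hW1 j k hk, (hW j k).1 hk⟩)
          have h2 := windowExponent_succ_le hC hm3
          rw [← hu] at h2
          refine h1.trans ?_
          rw [Nat.succ_eq_add_one]
          linarith
      _ = 1 / 96 := by
          rw [hκdef]
          field_simp
  obtain ⟨η, hη, havoid⟩ := exists_avoiding_balls (t := t) (δ := δ) (W := W) (q := q) (s := s)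
    hs₀ hs₁' (fun j => by positivity)
    (fun j => by
      refine pow_dvd_pow 2 (Nat.log_mono_right (Nat.floor_le_floor ?_))
      gcongr
      exact hmono (by omega))
    hδ0
    (fun j k hk => by
      refine (hqle j).trans (le_trans ?_ (ht k (hW1 j k hk)).1)
      gcongr
      exact ((hW j k).1 hk).1.le)
    htq hsum
    (fun j => by
      have h1 := (hJ (j + 1 + J) (by omega)).2.1
      calc 64 * (2 : ℝ) ^ j ≤ 64 * (2 : ℝ) ^ (j + 1 + J) := by
            gcongr
            · norm_num
            · omega
        _ ≤ _ := h1
        _ ≤ _ := Real.rpow_le_rpow (by positivity) (hqge (j + 1)) (by linarith))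
  refine le_dimH_of_exists_avoiding_balls hs₀ hη fun c ρ hρ hcρ => ?_
  obtain ⟨α, hα, hαW, hαb⟩ := havoid c ρ hρ hcρ
  refine ⟨α, ⟨hα, ?_⟩, hαb⟩
  have hlim : Tendsto (fun n : ℕ => (n : ℝ) ^ β) atTop atTop :=
    (tendsto_rpow_atTop hβ₀).comp tendsto_natCast_atTop_atTop
  filter_upwards [hlim.eventually_gt_atTop (u J)] with n hn
  -- The least such j is positive because n^β > u_J, and its predecessor indexes the window of n.
  have hex : ∃ j, (n : ℝ) ^ β ≤ u (j + J) :=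
    ((hulim.comp (tendsto_add_atTop_nat J)).eventually_ge_atTop ((n : ℝ) ^ β)).exists
  classical
  obtain ⟨i, hi⟩ : ∃ i, Nat.find hex = i + 1 := by
    refine Nat.exists_eq_succ_of_ne_zero fun h => ?_
    have := Nat.find_spec hex
    rw [h, zero_add] at this
    exact absurd hn (not_lt.2 this)
  refine hαW i n ((hW i n).2 ⟨not_le.1 (Nat.find_min hex (show i < _ by omega)), ?_⟩)
  have := Nat.find_spec hex
  rwa [hi, add_right_comm] at this

theorem mainTheorem6 (t : ℕ → ℝ) (β γ₁ γ₂ : ℝ)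
    (hβ₀ : 0 < β) (hβ₁ : β < 1) (hγ₁ : 0 < γ₁) (hγ₂ : 0 < γ₂)
    (ht : ∀ n : ℕ, 1 ≤ n →
      γ₁ * Real.exp ((n : ℝ) ^ β) ≤ t n ∧ t n ≤ γ₂ * Real.exp ((n : ℝ) ^ β)) :
    dimH {α : ℝ | α ∈ Set.Icc (0 : ℝ) 1 ∧
      ∃ κ : ℝ, 0 < κ ∧ ∀ n : ℕ, 1 ≤ n →
        κ / ((n : ℝ) ^ (1 - β) * Real.log ((n : ℝ) + 1)) < distNearestInt (t n * α)} = 1 := by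
  refine le_antisymm ((dimH_mono (subset_univ _)).trans Real.dimH_univ.le) ?_
  refine le_of_forall_lt fun r hr => ?_
  obtain ⟨s, hrs, hs₁⟩ := ENNReal.lt_iff_exists_nnreal_btwn.1 hr
  have hs₀ : 0 < s := by exact_mod_cast (zero_le (a := r)).trans_lt hrs
  obtain ⟨κ, hκ, hdim⟩ := exists_le_dimH_eventually hβ₀ hβ₁ hγ₁ hγ₂ ht hs₀ (by exact_mod_cast hs₁)
  have htpos : ∀ n, 1 ≤ n → 0 < t n := fun n hn =>
    (mul_pos hγ₁ (Real.exp_pos _)).trans_le (ht n hn).1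
  refine hrs.trans_le (hdim.trans ?_)
  have hcount := countable_setOf_distNearestInt_eq_zero htpos
  refine (dimH_mono ?_).trans ((dimH_union _ _).trans_le
    (max_le le_rfl (hcount.dimH_zero.trans_le zero_le)))
  rintro α ⟨hα, hev⟩
  by_cases hN : ∃ n, 1 ≤ n ∧ distNearestInt (t n * α) = 0
  · exact Or.inr hN
  push Not at hN
  have hden : ∀ n : ℕ, 1 ≤ n → 0 < (n : ℝ) ^ (1 - β) * Real.log ((n : ℝ) + 1) := fun n hn => by
    have : (1 : ℝ) ≤ n := by exact_mod_cast hn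
    exact mul_pos (Real.rpow_pos_of_pos (by linarith) _) (Real.log_pos (by linarith))
  obtain ⟨ε, hε, hlt⟩ := exists_pos_forall_lt
    (f := fun n => distNearestInt (t n * α) * ((n : ℝ) ^ (1 - β) * Real.log ((n : ℝ) + 1)))
    (fun n hn => mul_pos ((distNearestInt_nonneg _).lt_of_ne' (hN n hn)) (hden n hn)) hκ (by
      filter_upwards [hev, eventually_ge_atTop 1] with n hn hn1
      rwa [div_le_iff₀ (hden n hn1)] at hn)
  refine Or.inl ⟨hα, ε, hε, fun n hn => ?_⟩
  rw [div_lt_iff₀ (hden n hn)]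
  exact hlt n hn
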